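/- Let $d\ge 1$. For $f,g\in L^2(\mathbb R^d)$ let $$W(f,g)(x,\xi)=\int_{\mathbb R^d} f\left(x+\tfrac t2\right)\overline{g\left(x-\tfrac t2\right)}\,e^{-2\pi i\xi\cdot t}\,dt,\qquad x,\xi\in\mathbb R^d,$$ be the cross-Wigner distribution. Let $S=\begin{pmatrix}A&B\\ C&D\end{pmatrix}\in\mathrm{Sp}(d,\mathbb R)$ with $d\times d$ blocks, and let $\hat S$ be a metaplectic operator with projection $S$, that is, a unitary operator on $L^2(\mathbb R^d)$ such that $W(\hat Sf,\hat Sg)(x,\xi)=W(f,g)(S^{-1}(x,\xi))$ for all $f,g\in L^2(\mathbb R^d)$ and all $(x,\xi)\in\mathbb R^{2d}$. Assume that $1\le \operatorname{rank}(B)\le d$, i.e. $B\ne 0$. Let $M,N\in\mathbb R^{d\times d}$ be symmetric positive-semidefinite matrices with $$\ker(M)=\ker(B),\qquad R(N)=R(B),$$ where $R$ denotes the range. Let $f\in L^2(\mathbb R^d)$, and let $\alpha: D^TA(\ker B)\to[0,\infty]$ and $\beta:A(\ker B)\to[0,\infty]$ be measurable and almost everywhere finite. Assume that for almost every $x_2\in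 D^TA(\ker B)$ $$|f(x_1+x_2)|\le\alpha(x_2)\,e^{-\pi Mx_1\cdot x_1}\qquad\text{for almost every } x_1\in\ker(B)^\perp,$$ and that for almost every $\xi_2\in A(\ker B)$ $$|\hat Sf(\xi_1+\xi_2)|\le\beta(\xi_2)\,e^{-\pi N\xi_1\cdot\xi_1}\qquad\text{for almost every } \xi_1\in R(B),$$ where each of these subspaces carries its own Lebesgue measure (the unit point mass if the subspace is $\{0\}$). If the matrix $MB^TNB$ has an eigenvalue $\lambda>1$, then $f=0$ almost everywhere. -/

import Mathlib

open MeasureTheory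

noncomputable section

/-- `ℝ^d` with its Euclidean structure. -/
abbrev Euc (d : ℕ) : Type := EuclideanSpace ℝ (Fin d)

/-- `L²(ℝ^d)`, complex valued, with respect to Lebesgue measure. -/
abbrev L2Space (d : ℕ) : Type := Lp ℂ 2 (volume : Measure (Euc d))

/-- The cross-Wigner distribution
`W(f,g)(x,ξ) = ∫ f(x + t/2) conj(g(x - t/2)) e^{-2πi ξ·t} dt`. -/
def crossWigner {d : ℕ} (f g : Euc d → ℂ) (x ξ : Euc d) : ℂ :=
  ∫ t : Euc d, f (x + (1 / 2 : ℝ) • t) * starRingEnd ℂ (g (x - (1 / 2 : ℝ) • t)) *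
    Complex.exp (-2 * Real.pi * Complex.I * (inner ℝ ξ t : ℝ))

/-- The linear action of a `2d × 2d` matrix on phase space `ℝ^d × ℝ^d`. -/
def phaseAct {d : ℕ} (S : Matrix (Fin d ⊕ Fin d) (Fin d ⊕ Fin d) ℝ)
    (x ξ : Euc d) : Euc d × Euc d :=
  (WithLp.toLp 2 fun i => S.mulVec (Sum.elim x ξ) (Sum.inl i),
   WithLp.toLp 2 fun i => S.mulVec (Sum.elim x ξ) (Sum.inr i))

/-- `T` is a metaplectic operator with projection `S`: `S` is symplectic, and the unitary operator
`T` on `L²(ℝ^d)` satisfies `W(Tf,Tg)(x,ξ) = W(f,g)(S⁻¹(x,ξ))` for all `f, g, x, ξ`. -/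
def IsMetaplectic {d : ℕ} (S : Matrix (Fin d ⊕ Fin d) (Fin d ⊕ Fin d) ℝ)
    (T : L2Space d ≃ₗᵢ[ℂ] L2Space d) : Prop :=
  S ∈ Matrix.symplecticGroup (Fin d) ℝ ∧
  ∀ (f g : L2Space d) (x ξ : Euc d),
    crossWigner (T f) (T g) x ξ = crossWigner f g (phaseAct S⁻¹ x ξ).1 (phaseAct S⁻¹ x ξ).2

/-- The kernel of a matrix, as a subspace of `ℝ^d`. -/
def matKer {d : ℕ} (E : Matrix (Fin d) (Fin d) ℝ) : Submodule ℝ (Euc d) :=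
  LinearMap.ker (Matrix.toEuclideanLin E)

/-- The range of a matrix, as a subspace of `ℝ^d`. -/
def matRange {d : ℕ} (E : Matrix (Fin d) (Fin d) ℝ) : Submodule ℝ (Euc d) :=
  LinearMap.range (Matrix.toEuclideanLin E)

/-- The image `E(L)` of a subspace `L` under a matrix `E`. -/
def matImage {d : ℕ} (E : Matrix (Fin d) (Fin d) ℝ) (L : Submodule ℝ (Euc d)) :
    Submodule ℝ (Euc d) :=
  L.map (Matrix.toEuclideanLin E)

/-- The quadratic form `Ex · x`. -/
def matQuad {d : ℕ} (E : Matrix (Fin d) (Fin d) ℝ) (x : Euc d) : ℝ :=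
  inner ℝ (Matrix.toEuclideanLin E x) x

/-- The Lebesgue measure of a subspace `L` of `ℝ^d` (of its own dimension), normalized so that
the cube spanned by an orthonormal basis of `L` has measure one. -/
def lebesgueOn {d : ℕ} (L : Submodule ℝ (Euc d)) : Measure L :=
  (stdOrthonormalBasis ℝ L).toBasis.addHaar

end

/-!
Let `P` be the orthogonal projection onto `ker B`. For `k ∈ ker B` the ambiguity functions of `f` at
`(0, k)` and of `T f` at `(Bk, Dk) = (0, Dk)` agree, so the coordinate `P x` is distributed under
`|f|²` as the coordinate `P Dᵀ ξ` is under `|T f|²`. Hence `T` intertwines the cut-offs by a set of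
coordinates. Cutting off where `α` and `β` are bounded reduces the theorem to a function `g` that
lies at bounded distance from `(ker B)ᗮ` and is at most `K e^{-πMx₁·x₁}` there, while `T g` lies at
bounded distance from `R(B)` and is at most `K e^{-πNξ₁·ξ₁}` there.

An eigenvalue `λ > 1` of `MBᵀNB` yields a vector `y` with `My·y < N(Bw)·(Bw)`, where `w = My`. For a
test function `h` the Fourier–Laplace transform of `g h̄` in the direction `w` is entire of order
two. Its growth in the imaginary directions is at most `e^{πbs²}` for every `b > My·y`. On the real
axis it is the ambiguity function of `g` and `h` at `(0, sw)`, hence that of `T g` and `T h` at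
`(sBw, sDw)`, which decays like `e^{-πas²}` for every `a < N(Bw)·(Bw)` if `T h` is compactly
supported. With `b < a` Hardy's uncertainty principle makes it vanish, and its value at `0` is
`⟨h, g⟩ = ⟨T h, T g⟩`. As `T h` is arbitrary, `T g = 0`.
-/

noncomputable section

section Hardy

variable {E : Type*} [NormedAddCommGroup E] [NormedSpace ℂ E]

theorem norm_le_of_arg_mem_Icc {f : ℂ → E} (hf : Differentiable ℂ f) {n : ℕ}
    {α β A K C : ℝ} (hn : n < Real.pi / (β - α))
    (hgrowth : ∀ z, ‖f z‖ ≤ K * Real.exp (A * ‖z‖ ^ n))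
    (hα : ∀ r : ℝ, 0 ≤ r → ‖f (r * Complex.exp (α * Complex.I))‖ ≤ C)
    (hβ : ∀ r : ℝ, 0 ≤ r → ‖f (r * Complex.exp (β * Complex.I))‖ ≤ C)
    {z : ℂ} (hz : z.arg ∈ Set.Icc α β) : ‖f z‖ ≤ C := by
  obtain rfl | hz₀ := eq_or_ne z 0
  · simpa using hα 0 le_rfl
  have hpolar (w : ℂ) : Complex.exp w = Real.exp w.re * Complex.exp (w.im * Complex.I) := by
    rw [Complex.ofReal_exp, ← Complex.exp_add, Complex.re_add_im]
  rw [← Complex.exp_log hz₀]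
  refine PhragmenLindelof.horizontal_strip (f := fun w => f (Complex.exp w)) (a := α) (b := β)
    (hf.comp Complex.differentiable_exp).diffContOnCl ⟨n, hn, |A|, ?_⟩ ?_ ?_
    (hz.1.trans_eq (Complex.log_im z).symm) ((Complex.log_im z).trans_le hz.2)
  · refine Asymptotics.IsBigO.of_bound |K| (Filter.Eventually.of_forall fun w => ?_)
    rw [Real.norm_of_nonneg (Real.exp_nonneg _)]
    calc ‖f (Complex.exp w)‖ ≤ K * Real.exp (A * Real.exp (n * w.re)) := by
          simpa [Complex.norm_exp, ← Real.exp_nat_mul] using hgrowth (Complex.exp w)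
      _ ≤ |K| * Real.exp (|A| * Real.exp (n * |w.re|)) := by
          gcongr <;> exact le_abs_self _
  · intro w hw
    simpa only [hpolar w, hw] using hα _ (Real.exp_nonneg w.re)
  · intro w hw
    simpa only [hpolar w, hw] using hβ _ (Real.exp_nonneg w.re)

lemma norm_cexp_mul_sq_smul (c : ℝ) (z : ℂ) (v : E) :
    ‖Complex.exp (c * z ^ 2) • v‖ = Real.exp (c * (z.re ^ 2 - z.im ^ 2)) * ‖v‖ := by
  rw [norm_smul, Complex.norm_exp]
  simp [pow_two]

variable {F : ℂ → E} {a b c K : ℝ}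

lemma norm_cexp_mul_sq_smul_le_of_mul_sq_le (hK : 0 ≤ K)
    (hgrowth : ∀ z, ‖F z‖ ≤ K * Real.exp (b * z.im ^ 2))
    {z : ℂ} (hz : c * z.re ^ 2 ≤ (c - b) * z.im ^ 2) :
    ‖Complex.exp (c * z ^ 2) • F z‖ ≤ K := by
  rw [norm_cexp_mul_sq_smul]
  calc Real.exp (c * (z.re ^ 2 - z.im ^ 2)) * ‖F z‖
      ≤ Real.exp (c * (z.re ^ 2 - z.im ^ 2)) * (K * Real.exp (b * z.im ^ 2)) := by
        gcongr; exact hgrowth z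
    _ = K * Real.exp (c * z.re ^ 2 - (c - b) * z.im ^ 2) := by
        rw [mul_left_comm, ← Real.exp_add]; ring_nf
    _ ≤ K := mul_le_of_le_one_right hK (Real.exp_le_one_iff.2 (by linarith))

lemma norm_cexp_mul_sq_smul_ofReal_le {x : ℝ} (hreal : ‖F x‖ ≤ K * Real.exp (-a * x ^ 2)) :
    ‖Complex.exp (c * (x : ℂ) ^ 2) • F x‖ ≤ K * Real.exp (-(a - c) * x ^ 2) := by
  rw [norm_cexp_mul_sq_smul]
  calc Real.exp (c * ((x : ℂ).re ^ 2 - (x : ℂ).im ^ 2)) * ‖F x‖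
      ≤ Real.exp (c * ((x : ℂ).re ^ 2 - (x : ℂ).im ^ 2)) * (K * Real.exp (-a * x ^ 2)) := by
        gcongr
    _ = K * Real.exp (-(a - c) * x ^ 2) := by
        rw [mul_left_comm, ← Real.exp_add, Complex.ofReal_re, Complex.ofReal_im]; ring_nf

lemma norm_cexp_mul_sq_smul_le_exp_norm_sq (hb : 0 ≤ b) (hc : 0 ≤ c) (hK : 0 ≤ K)
    (hgrowth : ∀ z, ‖F z‖ ≤ K * Real.exp (b * z.im ^ 2)) (z : ℂ) :
    ‖Complex.exp (c * z ^ 2) • F z‖ ≤ K * Real.exp ((b + c) * ‖z‖ ^ 2) := by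
  rw [norm_cexp_mul_sq_smul]
  calc Real.exp (c * (z.re ^ 2 - z.im ^ 2)) * ‖F z‖
      ≤ Real.exp (c * (z.re ^ 2 - z.im ^ 2)) * (K * Real.exp (b * z.im ^ 2)) := by
        gcongr; exact hgrowth z
    _ = K * Real.exp (c * (z.re ^ 2 - z.im ^ 2) + b * z.im ^ 2) := by
        rw [mul_left_comm, ← Real.exp_add]
    _ ≤ K * Real.exp ((b + c) * ‖z‖ ^ 2) := by
        gcongr
        rw [← Complex.normSq_eq_norm_sq, Complex.normSq_apply]
        nlinarith [mul_nonneg hb (sq_nonneg z.re), mul_nonneg hc (sq_nonneg z.im)]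

lemma exists_mul_cos_sq_eq_mul_sin_sq {p q : ℝ} (hp : 0 < p) (hq : 0 < q) :
    ∃ θ ∈ Set.Ioo 0 (Real.pi / 2), p * Real.cos θ ^ 2 = q * Real.sin θ ^ 2 ∧
      ∀ z : ℂ, 0 ≤ z.re → q * z.im ^ 2 < p * z.re ^ 2 → |z.arg| ≤ θ := by
  set t : ℝ := √(p / q)
  have ht : 0 < t := Real.sqrt_pos.2 (div_pos hp hq)
  have htsq : t ^ 2 = p / q := Real.sq_sqrt (div_pos hp hq).le
  refine ⟨Real.arctan t, ⟨Real.arctan_pos.2 ht, Real.arctan_lt_pi_div_two t⟩, ?_, ?_⟩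
  · rw [Real.cos_sq_arctan, Real.sin_sq_arctan, htsq]
    field_simp
  · intro z hre hz
    have hre' : 0 < z.re := by
      refine hre.lt_of_ne' fun h => ?_
      rw [h] at hz
      nlinarith [mul_nonneg hq.le (sq_nonneg z.im)]
    have harg : z.arg = Real.arctan (z.im / z.re) := by
      have h := abs_lt.1 (Complex.abs_arg_lt_pi_div_two_iff.2 (Or.inl hre'))
      rw [← Complex.tan_arg, Real.arctan_tan h.1 h.2]
    have hslope : |z.im / z.re| ≤ t := by
      refine Real.abs_le_sqrt ?_
      rw [div_pow, div_le_div_iff₀ (by positivity) hq]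
      linarith
    rw [harg, abs_le, ← Real.arctan_neg]
    exact ⟨Real.arctan_mono (abs_le.1 hslope).1, Real.arctan_mono (abs_le.1 hslope).2⟩

lemma norm_cexp_mul_sq_smul_le_of_re_nonneg (hF : Differentiable ℂ F) (hb : 0 ≤ b) (hbc : b < c)
    (hca : c < a) (hreal : ∀ x : ℝ, ‖F x‖ ≤ K * Real.exp (-a * x ^ 2))
    (hgrowth : ∀ z, ‖F z‖ ≤ K * Real.exp (b * z.im ^ 2)) {z : ℂ} (hz : 0 ≤ z.re) :
    ‖Complex.exp (c * z ^ 2) • F z‖ ≤ K := by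
  have hK : 0 ≤ K := by simpa using (norm_nonneg _).trans (hreal 0)
  have hc : 0 < c := hb.trans_lt hbc
  obtain ⟨θ, ⟨hθ, hθ'⟩, hcone, harg⟩ := exists_mul_cos_sq_eq_mul_sin_sq hc (sub_pos.2 hbc)
  set G : ℂ → E := fun z => Complex.exp (c * z ^ 2) • F z
  have hG : Differentiable ℂ G := by fun_prop
  have hGgrowth := norm_cexp_mul_sq_smul_le_exp_norm_sq hb hc.le hK hgrowth
  have hopening : ((2 : ℕ) : ℝ) < Real.pi / θ := by
    rw [lt_div_iff₀ hθ]; push_cast; linarith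
  have haxis : ∀ r : ℝ, 0 ≤ r → ‖G (r * Complex.exp ((0 : ℝ) * Complex.I))‖ ≤ K := by
    intro r _
    rw [Complex.ofReal_zero, zero_mul, Complex.exp_zero, mul_one]
    refine (norm_cexp_mul_sq_smul_ofReal_le (hreal r)).trans (mul_le_of_le_one_right hK ?_)
    rw [Real.exp_le_one_iff]
    nlinarith [sq_nonneg r]
  have hray : ∀ φ : ℝ, φ = θ ∨ φ = -θ → ∀ r : ℝ, 0 ≤ r →
      ‖G (r * Complex.exp (φ * Complex.I))‖ ≤ K := by
    intro φ hφ r _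
    refine norm_cexp_mul_sq_smul_le_of_mul_sq_le hK hgrowth (le_of_eq ?_)
    rw [Complex.re_ofReal_mul, Complex.im_ofReal_mul, Complex.exp_ofReal_mul_I_re,
      Complex.exp_ofReal_mul_I_im]
    have hφcone : c * Real.cos φ ^ 2 = (c - b) * Real.sin φ ^ 2 := by
      rcases hφ with rfl | rfl
      · exact hcone
      · rwa [Real.cos_neg, Real.sin_neg, neg_sq]
    linear_combination r ^ 2 * hφcone
  -- On the steep cone the growth bound suffices; the two flat sectors left over have opening
  -- `θ < π / 2`, below the critical opening for growth of order two.
  rcases le_or_gt (c * z.re ^ 2) ((c - b) * z.im ^ 2) with hsteep | hflat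
  · exact norm_cexp_mul_sq_smul_le_of_mul_sq_le hK hgrowth hsteep
  obtain ⟨hlower, hupper⟩ := abs_le.1 (harg z hz hflat)
  rcases le_total 0 z.arg with h | h
  · exact norm_le_of_arg_mem_Icc hG (by simpa using hopening) hGgrowth haxis (hray θ (Or.inl rfl))
      ⟨h, hupper⟩
  · exact norm_le_of_arg_mem_Icc hG (by simpa using hopening) hGgrowth (hray (-θ) (Or.inr rfl))
      haxis ⟨hlower, h⟩

theorem eq_zero_of_gaussian_decay_of_gaussian_growth (hF : Differentiable ℂ F)
    {K₁ K₂ : ℝ} (hb : 0 ≤ b) (hba : b < a)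
    (hreal : ∀ x : ℝ, ‖F x‖ ≤ K₁ * Real.exp (-a * x ^ 2))
    (hgrowth : ∀ z, ‖F z‖ ≤ K₂ * Real.exp (b * z.im ^ 2)) : F = 0 := by
  obtain ⟨c, hbc, hca⟩ := exists_between hba
  set K := max K₁ K₂
  replace hreal (x : ℝ) : ‖F x‖ ≤ K * Real.exp (-a * x ^ 2) :=
    (hreal x).trans (by gcongr; exact le_max_left _ _)
  replace hgrowth (z : ℂ) : ‖F z‖ ≤ K * Real.exp (b * z.im ^ 2) :=
    (hgrowth z).trans (by gcongr; exact le_max_right _ _)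
  set G : ℂ → E := fun z => Complex.exp (c * z ^ 2) • F z
  have hbounded : ∀ z, ‖G z‖ ≤ K := by
    intro z
    rcases le_total 0 z.re with hz | hz
    · exact norm_cexp_mul_sq_smul_le_of_re_nonneg hF hb hbc hca hreal hgrowth hz
    · simpa [G] using norm_cexp_mul_sq_smul_le_of_re_nonneg (F := fun z => F (-z)) (z := -z)
        (hF.comp differentiable_neg) hb hbc hca (fun x => by simpa using hreal (-x))
        (fun z => by simpa using hgrowth (-z)) (by simpa using hz)
  have hconst : ∀ z, G z = G 0 := fun z =>
    (show Differentiable ℂ G by fun_prop).apply_eq_apply_of_bounded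
      (isBounded_iff_forall_norm_le.2 ⟨K, Set.forall_mem_range.2 hbounded⟩) z 0
  have hdecay : Filter.Tendsto (fun x : ℝ => K * Real.exp (-(a - c) * x ^ 2)) Filter.atTop
      (nhds 0) := by
    have h := (Filter.tendsto_pow_atTop two_ne_zero).const_mul_atTop_of_neg
      (neg_lt_zero.2 (sub_pos.2 hca))
    simpa using (Real.tendsto_exp_atBot.comp h).const_mul K
  have hzero : G 0 = 0 := by
    refine norm_le_zero_iff.1 (ge_of_tendsto' hdecay fun x => ?_)
    rw [← hconst x]
    exact norm_cexp_mul_sq_smul_ofReal_le (hreal x)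
  ext z
  exact (smul_eq_zero_iff_right (Complex.exp_ne_zero _)).1 ((hconst z).trans hzero)

end Hardy

section FourierLaplace

variable {X E : Type*} [MeasurableSpace X] {μ : Measure X} [NormedAddCommGroup E]
  [NormedSpace ℂ E] {ρ : X → E} {l : X → ℝ}

lemma norm_cexp_mul_ofReal (z : ℂ) (t : ℝ) : ‖Complex.exp (z * t)‖ = Real.exp (z.re * t) := by
  rw [Complex.norm_exp, Complex.re_mul_ofReal]

lemma exp_mul_mul_abs_le {x x₀ : ℝ} (hx : |x - x₀| ≤ 1) (t : ℝ) :
    Real.exp (x * t) * |t| ≤ Real.exp ((x₀ + 2) * t) + Real.exp ((x₀ - 2) * t) := by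
  have hshift : (x - x₀) * t ≤ |t| :=
    calc (x - x₀) * t ≤ |x - x₀| * |t| := (le_abs_self _).trans_eq (abs_mul _ _)
      _ ≤ |t| := mul_le_of_le_one_left (abs_nonneg t) hx
  calc Real.exp (x * t) * |t| ≤ Real.exp (x₀ * t + |t|) * Real.exp |t| := by
        gcongr
        · linarith
        · linarith [Real.add_one_le_exp |t|]
    _ = Real.exp (x₀ * t) * Real.exp |2 * t| := by
        rw [← Real.exp_add, ← Real.exp_add, abs_mul, abs_two]; ring_nf
    _ ≤ Real.exp (x₀ * t) * (Real.exp (2 * t) + Real.exp (-(2 * t))) := by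
        gcongr; exact Real.exp_abs_le _
    _ = Real.exp ((x₀ + 2) * t) + Real.exp ((x₀ - 2) * t) := by
        rw [mul_add, ← Real.exp_add, ← Real.exp_add]; ring_nf

theorem differentiable_integral_cexp_smul (hρ : AEStronglyMeasurable ρ μ) (hl : AEMeasurable l μ)
    (hmoment : ∀ R : ℝ, Integrable (fun x => Real.exp (R * l x) * ‖ρ x‖) μ) :
    Differentiable ℂ fun z : ℂ => ∫ x, Complex.exp (z * l x) • ρ x ∂μ := by
  intro z₀
  have hmeas (z : ℂ) : AEStronglyMeasurable (fun x => Complex.exp (z * l x) • ρ x) μ :=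
    AEStronglyMeasurable.smul (by fun_prop) hρ
  have hmeas' : AEStronglyMeasurable (fun x => (Complex.exp (z₀ * l x) * l x) • ρ x) μ :=
    AEStronglyMeasurable.smul (by fun_prop) hρ
  have hint : Integrable (fun x => Complex.exp (z₀ * l x) • ρ x) μ :=
    (hmoment z₀.re).mono' (hmeas z₀) (ae_of_all _ fun x => by
      rw [norm_smul, norm_cexp_mul_ofReal])
  have hbound : ∀ x, ∀ z ∈ Metric.ball z₀ 1, ‖(Complex.exp (z * l x) * l x) • ρ x‖ ≤
      Real.exp ((z₀.re + 2) * l x) * ‖ρ x‖ + Real.exp ((z₀.re - 2) * l x) * ‖ρ x‖ := by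
    intro x z hz
    have hre : |z.re - z₀.re| ≤ 1 :=
      (Complex.abs_re_le_norm (z - z₀)).trans (mem_ball_iff_norm.1 hz).le
    rw [norm_smul, norm_mul, norm_cexp_mul_ofReal, Complex.norm_real, Real.norm_eq_abs, ← add_mul]
    gcongr
    exact exp_mul_mul_abs_le hre (l x)
  have hderiv : ∀ x, ∀ z ∈ Metric.ball z₀ 1, HasDerivAt (fun z => Complex.exp (z * l x) • ρ x)
      ((Complex.exp (z * l x) * l x) • ρ x) z := fun x z _ => by
    simpa using ((hasDerivAt_id z).mul_const (l x : ℂ)).cexp.smul_const (ρ x)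
  exact (hasDerivAt_integral_of_dominated_loc_of_deriv_le (Metric.ball_mem_nhds z₀ one_pos)
    (Filter.Eventually.of_forall hmeas) hint hmeas' (ae_of_all _ hbound)
    ((hmoment _).add (hmoment _)) (ae_of_all _ hderiv)).2.differentiableAt

theorem integral_eq_zero_of_gaussian_bounds (hρ : AEStronglyMeasurable ρ μ) (hl : AEMeasurable l μ)
    {φ : X → ℝ} (hφ : Integrable φ μ) {a b K : ℝ} (hb : 0 ≤ b) (hba : b < a)
    (hlaplace : ∀ R : ℝ, ∀ᵐ x ∂μ, Real.exp (R * l x) * ‖ρ x‖ ≤ Real.exp (b * R ^ 2) * φ x)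
    (hfourier : ∀ s : ℝ,
      ‖∫ x, Complex.exp (s * Complex.I * l x) • ρ x ∂μ‖ ≤ K * Real.exp (-a * s ^ 2)) :
    ∫ x, ρ x ∂μ = 0 := by
  have hmoment (R : ℝ) : Integrable (fun x => Real.exp (R * l x) * ‖ρ x‖) μ := by
    refine (hφ.const_mul (Real.exp (b * R ^ 2))).mono'
      (AEStronglyMeasurable.mul (by fun_prop) hρ.norm) ?_
    filter_upwards [hlaplace R] with x hx
    rwa [Real.norm_of_nonneg (by positivity)]
  set L : ℂ → E := fun z => ∫ x, Complex.exp (z * l x) • ρ x ∂μ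
  have hgrowth (z : ℂ) :
      ‖L (z * Complex.I)‖ ≤ (∫ x, φ x ∂μ) * Real.exp (b * z.im ^ 2) := by
    rw [mul_comm (∫ x, φ x ∂μ), ← integral_const_mul]
    refine norm_integral_le_of_norm_le (hφ.const_mul _) ?_
    filter_upwards [hlaplace (-z.im)] with x hx
    rwa [norm_smul, norm_cexp_mul_ofReal, Complex.mul_I_re, ← neg_sq z.im]
  have hentire : Differentiable ℂ fun z => L (z * Complex.I) :=
    (differentiable_integral_cexp_smul hρ hl hmoment).comp (by fun_prop)
  simpa [L] using congrFun
    (eq_zero_of_gaussian_decay_of_gaussian_growth hentire hb hba hfourier hgrowth) 0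

end FourierLaplace

section CrossAmbiguity

variable {d : ℕ}

/-- The cross-ambiguity function `A(f,g)(p,q) = ∫ f(y + p/2) conj(g(y - p/2)) e^{-2πi q·y} dy`, the
symplectic Fourier transform of the cross-Wigner distribution. -/
def crossAmbiguity (f g : Euc d → ℂ) (p q : Euc d) : ℂ :=
  ∫ y : Euc d, f (y + (1 / 2 : ℝ) • p) * starRingEnd ℂ (g (y - (1 / 2 : ℝ) • p)) *
    Complex.exp (-2 * Real.pi * Complex.I * (inner ℝ q y : ℝ))

lemma crossAmbiguity_zero_smul (f g : Euc d → ℂ) (s : ℝ) (w : Euc d) :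
    crossAmbiguity f g 0 (s • w) =
      ∫ x, Complex.exp (s * Complex.I * ↑(-(2 * Real.pi) * inner ℝ w x)) •
        (f x * starRingEnd ℂ (g x)) := by
  refine integral_congr_ae (ae_of_all _ fun x => ?_)
  simp only [smul_zero, add_zero, sub_zero, real_inner_smul_left, smul_eq_mul]
  rw [mul_comm]
  congr 2
  push_cast
  ring

lemma integral_mul_conj_eq_inner (f g : L2Space d) :
    ∫ x, f x * starRingEnd ℂ (g x) = inner ℂ g f := by
  rw [L2.inner_def]
  simp

lemma crossAmbiguity_zero_zero (f g : L2Space d) : crossAmbiguity f g 0 0 = inner ℂ g f := by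
  simp [crossAmbiguity, integral_mul_conj_eq_inner]

lemma norm_crossAmbiguity_le (f g : Euc d → ℂ) (p q : Euc d) :
    ‖crossAmbiguity f g p q‖ ≤ ∫ y : Euc d, ‖f y‖ * ‖g (y - p)‖ := by
  have hphase (y : Euc d) :
      ‖Complex.exp (-2 * Real.pi * Complex.I * (inner ℝ q y : ℝ))‖ = 1 := by
    rw [Complex.norm_exp]
    simp
  calc ‖crossAmbiguity f g p q‖
      ≤ ∫ y : Euc d, ‖f (y + (1 / 2 : ℝ) • p)‖ * ‖g (y - (1 / 2 : ℝ) • p)‖ := by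
        refine (norm_integral_le_integral_norm _).trans_eq (integral_congr_ae (ae_of_all _ ?_))
        intro y
        simp only [norm_mul, hphase, mul_one, RCLike.norm_conj]
    _ = ∫ y : Euc d, ‖f (y + (1 / 2 : ℝ) • p)‖ * ‖g (y + (1 / 2 : ℝ) • p - p)‖ := by
        have hhalf (y : Euc d) : y + (1 / 2 : ℝ) • p - p = y - (1 / 2 : ℝ) • p := by module
        simp only [hhalf]
    _ = ∫ y : Euc d, ‖f y‖ * ‖g (y - p)‖ :=
        integral_add_right_eq_self (fun y => ‖f y‖ * ‖g (y - p)‖) _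

lemma crossWigner_comp_neg (f g : Euc d → ℂ) (x ξ : Euc d) :
    crossWigner f (fun y => g (-y)) x ξ =
      (2 : ℝ) ^ d • crossAmbiguity f g ((2 : ℝ) • x) ((2 : ℝ) • ξ) := by
  set F : Euc d → ℂ := fun y => f (y + x) * starRingEnd ℂ (g (y - x)) *
    Complex.exp (-2 * Real.pi * Complex.I * (inner ℝ ((2 : ℝ) • ξ) y : ℝ))
  have hwigner : crossWigner f (fun y => g (-y)) x ξ = ∫ t : Euc d, F ((1 / 2 : ℝ) • t) := by
    refine integral_congr_ae (ae_of_all _ fun t => ?_)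
    simp only [F, neg_sub, real_inner_smul_left, real_inner_smul_right, add_comm x]
    rw [← mul_assoc 2, mul_one_div_cancel two_ne_zero, one_mul]
  have hambiguity : crossAmbiguity f g ((2 : ℝ) • x) ((2 : ℝ) • ξ) = ∫ y, F y := by
    simp [crossAmbiguity, F, smul_smul]
  rw [hwigner, hambiguity, Measure.integral_comp_smul]
  simp

/-- The parity operator `f ↦ f (-·)` on `L²(ℝ^d)`. It turns cross-Wigner distributions into
cross-ambiguity functions. -/
def parity (f : L2Space d) : L2Space d :=
  Lp.compMeasurePreserving (fun x : Euc d => -x) (Measure.measurePreserving_neg volume) f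

lemma coeFn_parity (f : L2Space d) : parity f =ᵐ[volume] fun x => f (-x) :=
  Lp.coeFn_compMeasurePreserving f _

lemma parity_parity (f : L2Space d) : parity (parity f) = f := by
  refine Lp.ext ?_
  filter_upwards [coeFn_parity (parity f),
    (Measure.measurePreserving_neg volume).quasiMeasurePreserving.ae (coeFn_parity f)]
    with x hx hneg
  rw [hx, hneg, neg_neg]

lemma quasiMeasurePreserving_sub_smul (x : Euc d) {r : ℝ} (hr : r ≠ 0) :
    Measure.QuasiMeasurePreserving (fun t : Euc d => x - r • t) :=
  (Measure.measurePreserving_sub_left volume x).quasiMeasurePreserving.comp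
    (Measure.quasiMeasurePreserving_smul volume hr)

lemma crossWigner_parity (f g : L2Space d) (x ξ : Euc d) :
    crossWigner f (parity g) x ξ =
      (2 : ℝ) ^ d • crossAmbiguity f g ((2 : ℝ) • x) ((2 : ℝ) • ξ) := by
  rw [← crossWigner_comp_neg]
  refine integral_congr_ae ?_
  filter_upwards [(quasiMeasurePreserving_sub_smul x one_half_pos.ne').ae (coeFn_parity g)]
    with t ht
  rw [ht]

lemma phaseAct_smul (S : Matrix (Fin d ⊕ Fin d) (Fin d ⊕ Fin d) ℝ) (r : ℝ) (x ξ : Euc d) :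
    phaseAct S (r • x) (r • ξ) = r • phaseAct S x ξ := by
  have h : Sum.elim (r • x) (r • ξ) = r • (Sum.elim x ξ : Fin d ⊕ Fin d → ℝ) := by
    ext (i | i) <;> rfl
  unfold phaseAct
  rw [h, Matrix.mulVec_smul]
  rfl

lemma phaseAct_inv_phaseAct {S : Matrix (Fin d ⊕ Fin d) (Fin d ⊕ Fin d) ℝ} (hS : IsUnit S.det)
    (x ξ : Euc d) : phaseAct S⁻¹ (phaseAct S x ξ).1 (phaseAct S x ξ).2 = (x, ξ) := by
  have h : Sum.elim (phaseAct S x ξ).1 (phaseAct S x ξ).2 = S.mulVec (Sum.elim x ξ) := by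
    ext (i | i) <;> rfl
  unfold phaseAct at h ⊢
  rw [h, Matrix.mulVec_mulVec, Matrix.nonsing_inv_mul _ hS, Matrix.one_mulVec]
  rfl

lemma phaseAct_fromBlocks_zero_left (A B C D : Matrix (Fin d) (Fin d) ℝ) (ξ : Euc d) :
    phaseAct (Matrix.fromBlocks A B C D) 0 ξ =
      (Matrix.toEuclideanLin B ξ, Matrix.toEuclideanLin D ξ) := by
  ext i <;> simp [phaseAct, Matrix.fromBlocks_mulVec, Matrix.toLpLin_apply]

namespace IsMetaplectic

variable {T : L2Space d ≃ₗᵢ[ℂ] L2Space d}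

lemma map_parity {S : Matrix (Fin d ⊕ Fin d) (Fin d ⊕ Fin d) ℝ} (hT : IsMetaplectic S T)
    (g : L2Space d) : T (parity g) = parity (T g) := by
  have hreflect : parity (T (parity g)) = T g := by
    refine ext_inner_right ℂ fun v => ?_
    obtain ⟨f, rfl⟩ := T.surjective v
    have hzero : phaseAct S⁻¹ 0 0 = 0 := by simpa using phaseAct_smul S⁻¹ 0 0 0
    have h := hT.2 f (parity g) 0 0
    rw [hzero, Prod.fst_zero, Prod.snd_zero, ← parity_parity (T (parity g)), crossWigner_parity,
      crossWigner_parity, smul_zero, crossAmbiguity_zero_zero, crossAmbiguity_zero_zero] at h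
    rw [T.inner_map_map]
    exact smul_right_injective ℂ (by positivity : (2 : ℝ) ^ d ≠ 0) h
  rw [← hreflect, parity_parity]

theorem crossAmbiguity_phaseAct {S : Matrix (Fin d ⊕ Fin d) (Fin d ⊕ Fin d) ℝ}
    (hT : IsMetaplectic S T) (f g : L2Space d) (p q : Euc d) :
    crossAmbiguity (T f) (T g) (phaseAct S p q).1 (phaseAct S p q).2 = crossAmbiguity f g p q := by
  have hdouble (v : Euc d) : (2 : ℝ) • (1 / 2 : ℝ) • v = v := by module
  have h := hT.2 f (parity g) ((1 / 2 : ℝ) • phaseAct S p q).1 ((1 / 2 : ℝ) • phaseAct S p q).2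
  rw [hT.map_parity, crossWigner_parity, ← phaseAct_smul,
    phaseAct_inv_phaseAct (SymplecticGroup.symplectic_det hT.1), crossWigner_parity, phaseAct_smul,
    Prod.smul_fst, Prod.smul_snd, hdouble, hdouble, hdouble, hdouble] at h
  exact smul_right_injective ℂ (by positivity : (2 : ℝ) ^ d ≠ 0) h

theorem crossAmbiguity_fromBlocks {A B C D : Matrix (Fin d) (Fin d) ℝ}
    (hT : IsMetaplectic (Matrix.fromBlocks A B C D) T) (f g : L2Space d) (w : Euc d) :
    crossAmbiguity (T f) (T g) (Matrix.toEuclideanLin B w) (Matrix.toEuclideanLin D w) =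
      crossAmbiguity f g 0 w := by
  simpa only [phaseAct_fromBlocks_zero_left] using hT.crossAmbiguity_phaseAct f g 0 w

end IsMetaplectic

end CrossAmbiguity

section KernelCoordinates

variable {d : ℕ} {A B C D : Matrix (Fin d) (Fin d) ℝ}

lemma toEuclideanLin_mul_apply (E F : Matrix (Fin d) (Fin d) ℝ) (x : Euc d) :
    Matrix.toEuclideanLin (E * F) x = Matrix.toEuclideanLin E (Matrix.toEuclideanLin F x) := by
  simp [Matrix.toLpLin_apply, Matrix.mulVec_mulVec]

lemma inner_toEuclideanLin_left (E : Matrix (Fin d) (Fin d) ℝ) (x y : Euc d) :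
    inner ℝ (Matrix.toEuclideanLin E x) y = inner ℝ x (Matrix.toEuclideanLin E.transpose y) := by
  rw [← Matrix.conjTranspose_eq_transpose_of_trivial,
    Matrix.toEuclideanLin_conjTranspose_eq_adjoint, LinearMap.adjoint_inner_right]

/-- The `ker B`-coordinate `x ↦ P x` on the domain of a metaplectic operator, where `P` is the
orthogonal projection onto `ker B`. It vanishes on `(ker B)ᗮ` and inverts `DᵀA` on `ker B`. -/
def kerCoord (B : Matrix (Fin d) (Fin d) ℝ) : Euc d →L[ℝ] matKer B :=
  (matKer B).orthogonalProjectionOnto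

/-- The `ker B`-coordinate `y ↦ P Dᵀ y` on the target of a metaplectic operator, where `P` is the
orthogonal projection onto `ker B`. It vanishes on `R(B)` and inverts `A` on `ker B`. -/
def kerCoordTarget (B D : Matrix (Fin d) (Fin d) ℝ) : Euc d →L[ℝ] matKer B :=
  kerCoord B ∘L (Matrix.toEuclideanLin D.transpose).toContinuousLinearMap

lemma ker_kerCoord : (kerCoord B).ker = (matKer B)ᗮ :=
  Submodule.ker_orthogonalProjectionOnto

lemma kerCoord_coe (k : matKer B) : kerCoord B k = k :=
  Submodule.orthogonalProjectionOnto_mem_subspace_eq_self k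

lemma kerCoord_surjective : Function.Surjective (kerCoord B) := fun k => ⟨k, kerCoord_coe k⟩

lemma inner_kerCoord (x : Euc d) (k : matKer B) :
    inner ℝ (kerCoord B x) k = inner ℝ (k : Euc d) x := by
  rw [real_inner_comm]
  exact Submodule.inner_orthogonalProjectionOnto_eq_of_mem_left k x

lemma inner_kerCoordTarget (y : Euc d) (k : matKer B) :
    inner ℝ (kerCoordTarget B D y) k = inner ℝ (Matrix.toEuclideanLin D (k : Euc d)) y := by
  rw [inner_toEuclideanLin_left]
  exact inner_kerCoord _ k

lemma kerCoord_transpose_apply (x : Euc d) :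
    kerCoord B (Matrix.toEuclideanLin B.transpose x) = 0 := by
  refine ext_inner_right ℝ fun k => ?_
  rw [inner_kerCoord, ← inner_toEuclideanLin_left, LinearMap.mem_ker.1 k.2, inner_zero_left,
    inner_zero_left]

lemma kerCoord_transpose_mul_apply
    (hS : Matrix.fromBlocks A B C D ∈ Matrix.symplecticGroup (Fin d) ℝ) (k : matKer B) :
    kerCoord B (Matrix.toEuclideanLin (D.transpose * A) (k : Euc d)) = k := by
  have hone : D.transpose * A = 1 + B.transpose * C := by
    have h := congrArg Matrix.transpose (SymplecticGroup.fromBlocks_mem_iff.1 hS).2.2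
    simp only [Matrix.transpose_sub, Matrix.transpose_mul, Matrix.transpose_transpose,
      Matrix.transpose_one] at h
    exact sub_eq_iff_eq_add.1 h
  rw [hone, map_add, LinearMap.add_apply, map_add, toEuclideanLin_mul_apply,
    kerCoord_transpose_apply, add_zero, Matrix.toLpLin_one, LinearMap.id_apply, kerCoord_coe]

lemma kerCoordTarget_apply
    (hS : Matrix.fromBlocks A B C D ∈ Matrix.symplecticGroup (Fin d) ℝ) (k : matKer B) :
    kerCoordTarget B D (Matrix.toEuclideanLin A (k : Euc d)) = k := by
  have h := kerCoord_transpose_mul_apply hS k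
  rwa [toEuclideanLin_mul_apply] at h

-- `DᵀB = BᵀD` gives one inclusion, and the dimensions agree.
lemma ker_kerCoordTarget (hS : Matrix.fromBlocks A B C D ∈ Matrix.symplecticGroup (Fin d) ℝ) :
    (kerCoordTarget B D).ker = matRange B := by
  have hle : matRange B ≤ (kerCoordTarget B D).ker := by
    rintro _ ⟨x, rfl⟩
    change kerCoord B (Matrix.toEuclideanLin D.transpose (Matrix.toEuclideanLin B x)) = 0
    rw [← toEuclideanLin_mul_apply, ← (SymplecticGroup.fromBlocks_mem_iff.1 hS).2.1,
      toEuclideanLin_mul_apply, kerCoord_transpose_apply]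
  have hsurj : (kerCoordTarget B D).range = ⊤ :=
    LinearMap.range_eq_top.2 fun k => ⟨_, kerCoordTarget_apply hS k⟩
  have hB : Module.finrank ℝ (matRange B) + Module.finrank ℝ (matKer B) =
      Module.finrank ℝ (Euc d) := LinearMap.finrank_range_add_finrank_ker _
  have hcoord := LinearMap.finrank_range_add_finrank_ker (kerCoordTarget B D : Euc d →ₗ[ℝ] matKer B)
  rw [hsurj, finrank_top] at hcoord
  exact (Submodule.eq_of_le_of_finrank_eq hle (by omega)).symm

end KernelCoordinates

section Slices

open scoped ENNReal

theorem ae_mem_of_ae_ae_add_mem {V : Type*} [NormedAddCommGroup V] [NormedSpace ℝ V]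
    [FiniteDimensional ℝ V] [MeasurableSpace V] [BorelSpace V] {L₁ L₂ : Submodule ℝ V}
    (hL : Codisjoint L₁ L₂) {μ : Measure V} {μ₁ : Measure L₁} {μ₂ : Measure L₂}
    [μ.IsAddHaarMeasure] [μ₁.IsAddHaarMeasure] [μ₂.IsAddHaarMeasure] {s : Set V}
    (hs : MeasurableSet s) (hslice : ∀ᵐ x₂ : L₂ ∂μ₂, ∀ᵐ x₁ : L₁ ∂μ₁, (x₁ + x₂ : V) ∈ s) :
    ∀ᵐ x ∂μ, x ∈ s := by
  set sumMap : L₂ × L₁ →ₗ[ℝ] V := L₂.subtype.coprod L₁.subtype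
  have hsumMap : Function.Surjective sumMap := by
    intro x
    obtain ⟨x₁, x₂, hx₁, hx₂, rfl⟩ := Submodule.codisjoint_iff_exists_add_eq.1 hL x
    exact ⟨(⟨x₂, hx₂⟩, ⟨x₁, hx₁⟩), add_comm _ _⟩
  have hmeas : MeasurableSet (sumMap ⁻¹' s) := sumMap.continuous_of_finiteDimensional.measurable hs
  rw [← ae_comp_linearMap_mem_iff sumMap (μ₂.prod μ₁) μ hsumMap hs]
  refine (Measure.ae_prod_iff_ae_ae hmeas).2 ?_
  filter_upwards [hslice] with x₂ hx₂
  filter_upwards [hx₂] with x₁ hx₁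
  rwa [add_comm] at hx₁

instance isAddHaarMeasure_lebesgueOn {d : ℕ} (L : Submodule ℝ (Euc d)) :
    (lebesgueOn L).IsAddHaarMeasure := by
  unfold lebesgueOn; infer_instance

variable {d : ℕ} {K L : Submodule ℝ (Euc d)} {E : Euc d →ₗ[ℝ] Euc d} {p : Euc d →L[ℝ] K}

lemma codisjoint_ker_map_of_leftInverse (hE : ∀ k : K, p (E k) = k) :
    Codisjoint p.ker (K.map E) := by
  refine Submodule.codisjoint_iff_exists_add_eq.2 fun x => ⟨x - E (p x), E (p x), ?_, ?_, ?_⟩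
  · rw [LinearMap.mem_ker, map_sub]
    exact sub_eq_zero.2 (hE (p x)).symm
  · exact Submodule.mem_map_of_mem (p x).2
  · exact sub_add_cancel x _

theorem ae_le_mul_of_slices (hL : p.ker = L) (hE : ∀ k : K, p (E k) = k) {f w : Euc d → ℝ≥0∞}
    {α : K.map E → ℝ≥0∞} (hf : Measurable f) (hw : Measurable w) (hα : Measurable α)
    (hslice : ∀ᵐ x₂ : K.map E ∂lebesgueOn (K.map E), ∀ᵐ x₁ : L ∂lebesgueOn L,
      f ((x₁ : Euc d) + (x₂ : Euc d)) ≤ α x₂ * w (x₁ : Euc d)) :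
    ∀ᵐ x, f x ≤ α (E.submoduleMap K (p x)) * w (x - E (p x)) := by
  subst hL
  have hι : Measurable fun x => E.submoduleMap K (p x) :=
    (E.submoduleMap K).continuous_of_finiteDimensional.measurable.comp p.measurable
  have hEp : Measurable fun x => E (p x : Euc d) := measurable_subtype_coe.comp hι
  refine ae_mem_of_ae_ae_add_mem (μ₁ := lebesgueOn p.ker) (μ₂ := lebesgueOn (K.map E))
    (codisjoint_ker_map_of_leftInverse hE)
    (measurableSet_le hf ((hα.comp hι).mul (hw.comp (measurable_id.sub hEp)))) ?_
  filter_upwards [hslice] with x₂ hx₂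
  filter_upwards [hx₂] with x₁ hx₁
  obtain ⟨_, k, hk, rfl⟩ := x₂
  have hcoord : p (x₁ + E k) = ⟨k, hk⟩ := by
    rw [map_add, show p x₁ = 0 from x₁.2, zero_add]
    exact hE ⟨k, hk⟩
  change _ ≤ α _ * w _
  simp only [hcoord, add_sub_cancel_right]
  exact hx₁

lemma ae_lt_top_comp_of_surjective (hp : Function.Surjective p) {α : K.map E → ℝ≥0∞}
    (hα : Measurable α) (hfin : ∀ᵐ x ∂lebesgueOn (K.map E), α x < ⊤) :
    ∀ᵐ x, α (E.submoduleMap K (p x)) < ⊤ := by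
  have hsurj : Function.Surjective (E.submoduleMap K ∘ₗ (p : Euc d →ₗ[ℝ] K)) :=
    (E.submoduleMap_surjective K).comp hp
  exact (ae_comp_linearMap_mem_iff _ volume (lebesgueOn (K.map E)) hsurj
    (measurableSet_lt hα measurable_const)).2 hfin

end Slices

section Cutoff

variable {d : ℕ}

/-- The measure `|g(x)|² dx`, finite for `g ∈ L²(ℝ^d)`. -/
def energy (g : L2Space d) : Measure (Euc d) :=
  volume.withDensity fun x => ‖g x‖ₑ ^ 2

lemma measurable_enorm_sq (g : L2Space d) : Measurable fun x => ‖g x‖ₑ ^ 2 :=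
  (Lp.stronglyMeasurable g).enorm.pow_const 2

instance isFiniteMeasure_energy (g : L2Space d) : IsFiniteMeasure (energy g) := by
  refine isFiniteMeasure_withDensity (ne_of_lt ?_)
  simpa [HasFiniteIntegral, enorm_pow] using
    ((Lp.memLp g).integrable_norm_pow two_ne_zero).hasFiniteIntegral

lemma integral_energy (g : L2Space d) (φ : Euc d → ℂ) :
    ∫ x, φ x ∂energy g = ∫ x, g x * starRingEnd ℂ (g x) * φ x := by
  rw [energy, integral_withDensity_eq_integral_toReal_smul (measurable_enorm_sq g)
    (ae_of_all _ fun x => by finiteness)]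
  refine integral_congr_ae (ae_of_all _ fun x => ?_)
  simp [Complex.mul_conj, Complex.normSq_eq_norm_sq]

lemma ae_energy_iff (g : L2Space d) {P : Euc d → Prop} :
    (∀ᵐ x ∂energy g, P x) ↔ ∀ᵐ x, g x ≠ 0 → P x := by
  rw [energy, ae_withDensity_iff (measurable_enorm_sq g)]
  simp

lemma charFun_map_energy {V : Type*} [NormedAddCommGroup V] [InnerProductSpace ℝ V]
    [MeasurableSpace V] [BorelSpace V] [SecondCountableTopology V] (g : L2Space d) {p : Euc d → V}
    (hp : Measurable p) {t : V} {v : Euc d} (htv : ∀ x, inner ℝ (p x) t = inner ℝ v x) :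
    charFun ((energy g).map p) t = crossAmbiguity g g 0 (-(2 * Real.pi)⁻¹ • v) := by
  rw [charFun_apply, integral_map hp.aemeasurable (by fun_prop), integral_energy]
  refine integral_congr_ae (ae_of_all _ fun x => ?_)
  simp only [smul_zero, add_zero, sub_zero, htv, real_inner_smul_left]
  congr 2
  push_cast
  field_simp

/-- The restriction of `f ∈ L²(ℝ^d)` to a measurable set, extended by zero. -/
def cutoff {s : Set (Euc d)} (hs : MeasurableSet s) (f : L2Space d) : L2Space d :=
  ((Lp.memLp f).indicator hs).toLp

variable {s : Set (Euc d)}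

lemma coeFn_cutoff (hs : MeasurableSet s) (f : L2Space d) :
    cutoff hs f =ᵐ[volume] s.indicator f :=
  MemLp.coeFn_toLp _

lemma cutoff_add_cutoff_compl (hs : MeasurableSet s) (f : L2Space d) :
    cutoff hs f + cutoff hs.compl f = f := by
  refine Lp.ext ?_
  filter_upwards [Lp.coeFn_add (cutoff hs f) (cutoff hs.compl f), coeFn_cutoff hs f,
    coeFn_cutoff hs.compl f] with x hadd hx hx'
  rw [hadd, Pi.add_apply, hx, hx', Set.indicator_self_add_compl_apply]

lemma ae_mem_of_cutoff_ne_zero (hs : MeasurableSet s) (f : L2Space d) :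
    ∀ᵐ x, cutoff hs f x ≠ 0 → x ∈ s := by
  filter_upwards [coeFn_cutoff hs f] with x hx hne
  exact Set.mem_of_indicator_ne_zero (hx ▸ hne)

lemma cutoff_eq_of_add {f g h : L2Space d} (hs : MeasurableSet s) (hadd : g + h = f)
    (hg : ∀ᵐ x, g x ≠ 0 → x ∈ s) (hh : ∀ᵐ x, h x ≠ 0 → x ∈ sᶜ) : g = cutoff hs f := by
  subst hadd
  refine Lp.ext ?_
  filter_upwards [coeFn_cutoff hs (g + h), Lp.coeFn_add g h, hg, hh] with x hcut hsum hgx hhx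
  rw [hcut]
  by_cases hx : x ∈ s
  · rw [Set.indicator_of_mem hx, hsum, Pi.add_apply, not_not.1 fun hne => hhx hne hx, add_zero]
  · rw [Set.indicator_of_notMem hx, not_not.1 (mt hgx hx)]

lemma ae_eq_zero_of_cutoff_eq_zero {ι : Type*} [Countable ι] {s : ι → Set (Euc d)}
    (hs : ∀ i, MeasurableSet (s i)) {f : L2Space d} (hzero : ∀ i, cutoff (hs i) f = 0)
    (hcover : ∀ᵐ x, ∃ i, x ∈ s i) : f =ᵐ[volume] 0 := by
  have hvanish (i : ι) : ∀ᵐ x, x ∈ s i → f x = 0 := by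
    filter_upwards [coeFn_cutoff (hs i) f, Lp.eq_zero_iff_ae_eq_zero.1 (hzero i)] with x hx h0 hxs
    rwa [h0, Set.indicator_of_mem hxs, eq_comm] at hx
  filter_upwards [hcover, ae_all_iff.2 hvanish] with x ⟨i, hi⟩ h
  exact h i hi

end Cutoff

namespace IsMetaplectic

variable {d : ℕ} {A B C D : Matrix (Fin d) (Fin d) ℝ} {T : L2Space d ≃ₗᵢ[ℂ] L2Space d}
  {s : Set (matKer B)}

theorem map_kerCoord_energy (hT : IsMetaplectic (Matrix.fromBlocks A B C D) T) (g : L2Space d) :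
    (energy (T g)).map (kerCoordTarget B D) = (energy g).map (kerCoord B) := by
  refine Measure.ext_of_charFun (funext fun t => ?_)
  have h := hT.crossAmbiguity_fromBlocks g g (-(2 * Real.pi)⁻¹ • (t : Euc d))
  rw [map_smul, LinearMap.mem_ker.1 t.2, smul_zero, map_smul] at h
  rw [charFun_map_energy (T g) (kerCoordTarget B D).measurable fun y => inner_kerCoordTarget y t,
    charFun_map_energy g (kerCoord B).measurable fun x => inner_kerCoord x t, h]

lemma ae_kerCoordTarget_mem (hT : IsMetaplectic (Matrix.fromBlocks A B C D) T) {g : L2Space d}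
    (hs : MeasurableSet s) (hg : ∀ᵐ x, g x ≠ 0 → kerCoord B x ∈ s) :
    ∀ᵐ y, T g y ≠ 0 → kerCoordTarget B D y ∈ s := by
  rw [← ae_energy_iff] at hg ⊢
  refine (ae_map_iff (kerCoordTarget B D).measurable.aemeasurable hs).1 ?_
  rw [hT.map_kerCoord_energy]
  exact (ae_map_iff (kerCoord B).measurable.aemeasurable hs).2 hg

theorem map_cutoff (hT : IsMetaplectic (Matrix.fromBlocks A B C D) T) (hs : MeasurableSet s)
    (f : L2Space d) : T (cutoff ((kerCoord B).measurable hs) f) =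
      cutoff ((kerCoordTarget B D).measurable hs) (T f) := by
  refine cutoff_eq_of_add _ ?_ (hT.ae_kerCoordTarget_mem hs (ae_mem_of_cutoff_ne_zero _ f))
    (hT.ae_kerCoordTarget_mem hs.compl
      (ae_mem_of_cutoff_ne_zero ((kerCoord B).measurable hs).compl f))
  rw [← map_add, cutoff_add_cutoff_compl]

end IsMetaplectic

section QuadraticForms

variable {d : ℕ} {B M N : Matrix (Fin d) (Fin d) ℝ}

open scoped MatrixOrder in
lemma exists_inner_eq_inner_of_posSemidef (hM : M.PosSemidef) : ∃ Q : Euc d →ₗ[ℝ] Euc d,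
    ∀ x y, inner ℝ (Matrix.toEuclideanLin M x) y = inner ℝ (Q x) (Q y) := by
  obtain ⟨E, rfl⟩ := CStarAlgebra.nonneg_iff_eq_star_mul_self.1 hM.nonneg
  refine ⟨Matrix.toEuclideanLin E, fun x y => ?_⟩
  rw [toEuclideanLin_mul_apply, inner_toEuclideanLin_left, Matrix.star_eq_conjTranspose,
    Matrix.conjTranspose_eq_transpose_of_trivial, Matrix.transpose_transpose]

lemma matQuad_nonneg (hM : M.PosSemidef) (x : Euc d) : 0 ≤ matQuad M x := by
  obtain ⟨Q, hQ⟩ := exists_inner_eq_inner_of_posSemidef hM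
  rw [matQuad, hQ]
  exact real_inner_self_nonneg

lemma matQuad_eq_zero_iff (hM : M.PosSemidef) {x : Euc d} : matQuad M x = 0 ↔ x ∈ matKer M := by
  obtain ⟨Q, hQ⟩ := exists_inner_eq_inner_of_posSemidef hM
  refine ⟨fun h => LinearMap.mem_ker.2 (ext_inner_right ℝ fun y => ?_), fun h => ?_⟩
  · rw [matQuad, hQ, inner_self_eq_zero] at h
    rw [hQ, h, inner_zero_left, inner_zero_left]
  · rw [matQuad, LinearMap.mem_ker.1 h, inner_zero_left]

lemma two_mul_inner_toEuclideanLin_le (hM : M.PosSemidef) (x y : Euc d) {t : ℝ} (ht : 0 < t) :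
    2 * inner ℝ (Matrix.toEuclideanLin M y) x ≤ t * matQuad M x + t⁻¹ * matQuad M y := by
  obtain ⟨Q, hQ⟩ := exists_inner_eq_inner_of_posSemidef hM
  simp only [matQuad, hQ, real_inner_self_eq_norm_sq]
  have hamgm := two_mul_le_add_mul_sq (a := ‖Q x‖) (b := ‖Q y‖) ht
  have hcauchy := real_inner_le_norm (Q y) (Q x)
  linarith

lemma exists_mul_norm_sq_le_matQuad (hM : M.PosSemidef) :
    ∃ m > 0, ∀ x ∈ (matKer M)ᗮ, m * ‖x‖ ^ 2 ≤ matQuad M x := by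
  obtain ⟨Q, hQ⟩ := exists_inner_eq_inner_of_posSemidef hM
  have hker : (Q.domRestrict (matKer M)ᗮ).ker = ⊥ := by
    refine LinearMap.ker_eq_bot'.2 fun x hx => ?_
    have hx' : Q x = 0 := hx
    have hmem : (x : Euc d) ∈ matKer M := by
      rw [← matQuad_eq_zero_iff hM, matQuad, hQ, hx', inner_zero_left]
    exact Subtype.ext (inner_self_eq_zero.1 (Submodule.inner_right_of_mem_orthogonal hmem x.2))
  obtain ⟨k, hk, hanti⟩ := LinearMap.exists_antilipschitzWith _ hker
  have hk_sq : 0 < (k : ℝ) ^ 2 := pow_pos hk 2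
  refine ⟨((k : ℝ) ^ 2)⁻¹, inv_pos.2 hk_sq, fun x hx => ?_⟩
  have hle : ‖x‖ ≤ k * ‖Q x‖ := by simpa using hanti.le_mul_dist ⟨x, hx⟩ 0
  rw [matQuad, hQ, real_inner_self_eq_norm_sq, inv_mul_le_iff₀ hk_sq, ← mul_pow]
  gcongr

lemma two_mul_mul_le_of_abs_le {δ u P : ℝ} (hδ : 0 < δ) (hu : |u| ≤ P) (s : ℝ) :
    2 * s * u ≤ δ * s ^ 2 + δ⁻¹ * P ^ 2 :=
  (two_mul_le_add_mul_sq hδ).trans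
    (by gcongr δ * s ^ 2 + δ⁻¹ * ?_; exact sq_le_sq.2 (hu.trans (le_abs_self P)))

theorem exists_neg_matQuad_add_inner_le (hM : M.PosSemidef) {y : Euc d} {b : ℝ}
    (hb : matQuad M y < b) (ρ : ℝ) :
    ∃ C, ∃ c > 0, ∀ R : ℝ, ∀ x₁ ∈ (matKer M)ᗮ, ∀ x, ‖x - x₁‖ ≤ ρ →
      -matQuad M x₁ + 2 * R * inner ℝ (Matrix.toEuclideanLin M y) x ≤
        C + b * R ^ 2 - c * ‖x‖ ^ 2 := by
  have hb0 : 0 < b := (matQuad_nonneg hM y).trans_lt hb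
  obtain ⟨t, htb, ht1⟩ := exists_between (max_lt ((div_lt_one hb0).2 hb) one_pos)
  obtain ⟨hyt, ht0⟩ := max_lt_iff.1 htb
  have hη : 0 < b - t⁻¹ * matQuad M y := by
    rw [sub_pos, inv_mul_lt_iff₀ ht0]
    exact (div_lt_iff₀ hb0).1 hyt
  obtain ⟨m, hm, hcoer⟩ := exists_mul_norm_sq_le_matQuad hM
  have hc : 0 < (1 - t) * m / 2 := by
    have := sub_pos.2 ht1
    positivity
  set η := b - t⁻¹ * matQuad M y with hη_def
  set w := Matrix.toEuclideanLin M y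
  refine ⟨η⁻¹ * (‖w‖ * ρ) ^ 2 + (1 - t) * m * ρ ^ 2, _, hc, fun R x₁ hx₁ x hx => ?_⟩
  have hquad : 2 * (R * inner ℝ w x₁) ≤ t * matQuad M x₁ + t⁻¹ * (R ^ 2 * matQuad M y) := by
    have h := two_mul_inner_toEuclideanLin_le hM x₁ (R • y) ht0
    simp only [matQuad, map_smul, real_inner_smul_left, real_inner_smul_right] at h
    simp only [matQuad, pow_two, mul_assoc]
    exact h
  have hdisp : 2 * R * inner ℝ w (x - x₁) ≤ η * R ^ 2 + η⁻¹ * (‖w‖ * ρ) ^ 2 :=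
    two_mul_mul_le_of_abs_le hη ((abs_real_inner_le_norm _ _).trans (by gcongr)) R
  have hnorm : ‖x‖ ^ 2 ≤ 2 * (‖x₁‖ ^ 2 + ρ ^ 2) := by
    have h : ‖x‖ ≤ ‖x₁‖ + ρ := (norm_le_norm_add_norm_sub' x x₁).trans (by gcongr)
    exact (pow_le_pow_left₀ (norm_nonneg x) h 2).trans add_sq_le
  have hcoer' := mul_le_mul_of_nonneg_left (hcoer x₁ hx₁) (sub_pos.2 ht1).le
  have hnorm' := mul_le_mul_of_nonneg_left hnorm hc.le
  rw [inner_sub_right] at hdisp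
  rw [hη_def] at hdisp ⊢
  linarith

theorem exists_mul_sq_le_matQuad_add {v : Euc d} {a : ℝ}
    (ha : a < matQuad N v) (ρ : ℝ) :
    ∃ C, ∀ (s : ℝ) (x : Euc d), ‖x - s • v‖ ≤ ρ → a * s ^ 2 ≤ matQuad N x + C := by
  set E := (Matrix.toEuclideanLin N).toContinuousLinearMap
  have hbound (x y : Euc d) : |inner ℝ (Matrix.toEuclideanLin N x) y| ≤ ‖E‖ * (‖x‖ * ‖y‖) :=
    (abs_real_inner_le_norm _ _).trans (by rw [← mul_assoc]; gcongr; exact E.le_opNorm x)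
  have hδ : 0 < matQuad N v - a := sub_pos.2 ha
  refine ⟨(matQuad N v - a)⁻¹ * (‖E‖ * (‖v‖ * ρ)) ^ 2 + ‖E‖ * (ρ * ρ), fun s x hx => ?_⟩
  set z := x - s • v with hz
  set u : ℝ := inner ℝ (Matrix.toEuclideanLin N v) z + inner ℝ (Matrix.toEuclideanLin N z) v
  have hexpand : matQuad N x = matQuad N z + s * u + s ^ 2 * matQuad N v := by
    rw [← sub_add_cancel x (s • v), ← hz]
    simp only [matQuad, map_add, map_smul, inner_add_left, inner_add_right, real_inner_smul_left,
      real_inner_smul_right, u]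
    ring
  have hu : |-u / 2| ≤ ‖E‖ * (‖v‖ * ρ) := by
    have hρ : ‖E‖ * (‖v‖ * ‖z‖) ≤ ‖E‖ * (‖v‖ * ρ) := by gcongr
    have hvz := hbound v z
    have hzv := hbound z v
    rw [abs_div, abs_neg, abs_two, div_le_iff₀ two_pos]
    rw [mul_comm ‖z‖] at hzv
    exact (abs_add_le _ _).trans (by linarith)
  have hz_quad : -matQuad N z ≤ ‖E‖ * (ρ * ρ) :=
    (neg_le_abs _).trans ((hbound z z).trans (by gcongr; exact (norm_nonneg z).trans hx))
  linarith [two_mul_mul_le_of_abs_le hδ hu s]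

theorem exists_matQuad_lt_of_hasEigenvalue (hM : M.PosSemidef) {lam : ℝ} (hlam : 1 < lam)
    (heig : Module.End.HasEigenvalue (Matrix.toLin' (M * B.transpose * N * B)) lam) :
    ∃ y, matQuad M y < matQuad N (Matrix.toEuclideanLin B (Matrix.toEuclideanLin M y)) := by
  obtain ⟨v, hv⟩ := heig.exists_hasEigenvector
  set w : Euc d := WithLp.toLp 2 v
  have hw : w ≠ 0 := fun h => hv.2 (by simpa [w] using h)
  have hlam0 : 0 < lam := one_pos.trans hlam
  set y := lam⁻¹ • Matrix.toEuclideanLin B.transpose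
    (Matrix.toEuclideanLin N (Matrix.toEuclideanLin B w)) with hy
  have hMy : Matrix.toEuclideanLin M y = w := by
    rw [hy, map_smul, ← toEuclideanLin_mul_apply, ← toEuclideanLin_mul_apply,
      ← toEuclideanLin_mul_apply, Matrix.toLpLin_apply, ← Matrix.toLin'_apply, hv.apply_eq_smul,
      WithLp.toLp_smul, inv_smul_smul₀ hlam0.ne']
  have hquad : matQuad M y = lam⁻¹ * matQuad N (Matrix.toEuclideanLin B w) := by
    rw [matQuad, hMy, hy, real_inner_smul_right, ← inner_toEuclideanLin_left, real_inner_comm,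
      matQuad]
  have hpos : 0 < matQuad M y := (matQuad_nonneg hM y).lt_of_ne' fun h =>
    hw (hMy ▸ LinearMap.mem_ker.1 ((matQuad_eq_zero_iff hM).1 h))
  refine ⟨y, ?_⟩
  rw [hMy]
  rw [hquad] at hpos ⊢
  exact mul_lt_of_lt_one_left (pos_of_mul_pos_right hpos (inv_pos.2 hlam0).le)
    (inv_lt_one_of_one_lt₀ hlam)

end QuadraticForms

section GaussianBounds

open scoped ENNReal

variable {d : ℕ} {M N : Matrix (Fin d) (Fin d) ℝ} {L : Submodule ℝ (Euc d)} {g : L2Space d}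

/-- `g` is supported at bounded distance from the subspace `L`, and there it is at most a constant
multiple of the Gaussian `e^{-π Mx₁·x₁}` for some nearby point `x₁` of `L`. -/
def HasGaussianBound (M : Matrix (Fin d) (Fin d) ℝ) (L : Submodule ℝ (Euc d)) (g : L2Space d) :
    Prop :=
  ∃ K ρ : ℝ, ∀ᵐ x, g x ≠ 0 →
    ∃ x₁ ∈ L, ‖x - x₁‖ ≤ ρ ∧ ‖g x‖ ≤ K * Real.exp (-Real.pi * matQuad M x₁)

lemma HasGaussianBound.mono {L' : Submodule ℝ (Euc d)} (hL : L ≤ L')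
    (hg : HasGaussianBound M L g) : HasGaussianBound M L' g := by
  obtain ⟨K, ρ, hbound⟩ := hg
  refine ⟨K, ρ, hbound.mono fun x hx hne => ?_⟩
  obtain ⟨x₁, hx₁, h⟩ := hx hne
  exact ⟨x₁, hL hx₁, h⟩

lemma norm_le_mul_of_enorm_le {z : ℂ} {α : ℝ≥0∞} {n : ℕ} {t : ℝ} (ht : 0 ≤ t) (hα : α ≤ n)
    (hz : ‖z‖ₑ ≤ α * ENNReal.ofReal t) : ‖z‖ ≤ n * t := by
  refine (ENNReal.ofReal_le_ofReal_iff (by positivity)).1 ?_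
  rw [ofReal_norm, ENNReal.ofReal_mul n.cast_nonneg, ENNReal.ofReal_natCast]
  exact hz.trans (by gcongr)

lemma continuous_matQuad (M : Matrix (Fin d) (Fin d) ℝ) : Continuous (matQuad M) :=
  (LinearMap.continuous_of_finiteDimensional (Matrix.toEuclideanLin M)).inner continuous_id

theorem hasGaussianBound_cutoff {K : Submodule ℝ (Euc d)} {E : Euc d →ₗ[ℝ] Euc d}
    {p : Euc d →L[ℝ] K} (hL : p.ker = L) (hE : ∀ k : K, p (E k) = k) {f : L2Space d}
    {α : K.map E → ℝ≥0∞} (hα : Measurable α)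
    (hslice : ∀ᵐ x₂ : K.map E ∂lebesgueOn (K.map E), ∀ᵐ x₁ : L ∂lebesgueOn L,
      ‖f ((x₁ : Euc d) + (x₂ : Euc d))‖ₑ ≤
        α x₂ * ENNReal.ofReal (Real.exp (-Real.pi * matQuad M x₁)))
    {s : Set K} (hs : MeasurableSet s) {n : ℕ}
    (hsn : ∀ k ∈ s, α (E.submoduleMap K k) ≤ n ∧ ‖k‖ ≤ n) :
    HasGaussianBound M L (cutoff (p.measurable hs) f) := by
  have hw : Measurable fun x => ENNReal.ofReal (Real.exp (-Real.pi * matQuad M x)) := by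
    have := (continuous_matQuad M).measurable
    fun_prop
  refine ⟨n, ‖E.toContinuousLinearMap‖ * n, ?_⟩
  filter_upwards [coeFn_cutoff (p.measurable hs) f, ae_mem_of_cutoff_ne_zero (p.measurable hs) f,
    ae_le_mul_of_slices hL hE (Lp.stronglyMeasurable f).enorm hw hα hslice] with x hcut hmem hx hne
  have hxs : x ∈ p ⁻¹' s := hmem hne
  refine ⟨x - E (p x), ?_, ?_, ?_⟩
  · rw [← hL, LinearMap.mem_ker, map_sub]
    exact sub_eq_zero.2 (hE (p x)).symm
  · rw [sub_sub_cancel]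
    exact (E.toContinuousLinearMap.le_opNorm _).trans (by gcongr; exact (hsn _ hxs).2)
  · rw [hcut, Set.indicator_of_mem hxs]
    exact norm_le_mul_of_enorm_le (Real.exp_nonneg _) (hsn _ hxs).1 hx

lemma HasGaussianBound.exists_exp_mul_norm_le (hM : M.PosSemidef)
    (hg : HasGaussianBound M (matKer M)ᗮ g) {y : Euc d} {b : ℝ} (hb : matQuad M y < b) :
    ∃ K, ∃ c > 0, ∀ R : ℝ, ∀ᵐ x,
      Real.exp (2 * Real.pi * R * inner ℝ (Matrix.toEuclideanLin M y) x) * ‖g x‖ ≤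
        Real.exp (Real.pi * b * R ^ 2) * (K * Real.exp (-c * ‖x‖ ^ 2)) := by
  obtain ⟨K, ρ, hbound⟩ := hg
  obtain ⟨C, c, hc, hform⟩ := exists_neg_matQuad_add_inner_le hM hb ρ
  refine ⟨|K| * Real.exp (Real.pi * C), Real.pi * c, by positivity, fun R => ?_⟩
  filter_upwards [hbound] with x hx
  rcases eq_or_ne (g x) 0 with h0 | hne
  · rw [h0, norm_zero, mul_zero]
    positivity
  obtain ⟨x₁, hx₁, hdist, hle⟩ := hx hne
  have hexp := mul_le_mul_of_nonneg_left (hform R x₁ hx₁ x hdist) Real.pi_pos.le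
  calc Real.exp (2 * Real.pi * R * inner ℝ (Matrix.toEuclideanLin M y) x) * ‖g x‖
      ≤ Real.exp (2 * Real.pi * R * inner ℝ (Matrix.toEuclideanLin M y) x) *
          (|K| * Real.exp (-Real.pi * matQuad M x₁)) := by
        gcongr
        exact hle.trans (by gcongr; exact le_abs_self K)
    _ = |K| * Real.exp (2 * Real.pi * R * inner ℝ (Matrix.toEuclideanLin M y) x +
          -Real.pi * matQuad M x₁) := by
        rw [Real.exp_add]
        ring
    _ ≤ |K| * Real.exp (Real.pi * b * R ^ 2 + Real.pi * C + -(Real.pi * c) * ‖x‖ ^ 2) :=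
        mul_le_mul_of_nonneg_left (Real.exp_le_exp.2 (by linarith)) (abs_nonneg K)
    _ = _ := by
        rw [Real.exp_add, Real.exp_add]
        ring

lemma HasGaussianBound.exists_norm_le (hg : HasGaussianBound N L g) {v : Euc d} {a : ℝ}
    (ha : a < matQuad N v) (r : ℝ) :
    ∃ K, ∀ s : ℝ, ∀ᵐ x, ‖x - s • v‖ ≤ r → ‖g x‖ ≤ K * Real.exp (-(Real.pi * a) * s ^ 2) := by
  obtain ⟨K, ρ, hbound⟩ := hg
  obtain ⟨C, hform⟩ := exists_mul_sq_le_matQuad_add ha (ρ + r)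
  refine ⟨|K| * Real.exp (Real.pi * C), fun s => ?_⟩
  filter_upwards [hbound] with x hx hxr
  rcases eq_or_ne (g x) 0 with h0 | hne
  · rw [h0, norm_zero]
    positivity
  obtain ⟨x₁, -, hdist, hle⟩ := hx hne
  have hnear : ‖x₁ - s • v‖ ≤ ρ + r :=
    (norm_sub_le_norm_sub_add_norm_sub x₁ x (s • v)).trans
      (add_le_add (norm_sub_rev x₁ x ▸ hdist) hxr)
  have hexp := mul_le_mul_of_nonneg_left (hform s x₁ hnear) Real.pi_pos.le
  calc ‖g x‖ ≤ |K| * Real.exp (-Real.pi * matQuad N x₁) :=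
        hle.trans (by gcongr; exact le_abs_self K)
    _ ≤ |K| * Real.exp (Real.pi * C + -(Real.pi * a) * s ^ 2) :=
        mul_le_mul_of_nonneg_left (Real.exp_le_exp.2 (by linarith)) (abs_nonneg K)
    _ = _ := by rw [Real.exp_add, mul_assoc]

lemma HasGaussianBound.exists_norm_crossAmbiguity_le (hg : HasGaussianBound N L g) {v : Euc d}
    {a : ℝ} (ha : a < matQuad N v) {u : L2Space d} (hu : Integrable u) {r : ℝ}
    (hur : ∀ᵐ x, u x ≠ 0 → ‖x‖ ≤ r) :
    ∃ K, ∀ (s : ℝ) (q : Euc d),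
      ‖crossAmbiguity g u (s • v) q‖ ≤ K * Real.exp (-(Real.pi * a) * s ^ 2) := by
  obtain ⟨K, hK⟩ := hg.exists_norm_le ha r
  refine ⟨K * ∫ x, ‖u x‖, fun s q => (norm_crossAmbiguity_le g u _ q).trans ?_⟩
  have hshift := (measurePreserving_sub_right volume (s • v)).quasiMeasurePreserving.ae hur
  calc ∫ x, ‖g x‖ * ‖u (x - s • v)‖
      ≤ ∫ x, K * Real.exp (-(Real.pi * a) * s ^ 2) * ‖u (x - s • v)‖ := by
        refine integral_mono_of_nonneg (ae_of_all _ fun x => by positivity)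
          ((hu.norm.comp_sub_right (s • v)).const_mul _) ?_
        filter_upwards [hK s, hshift] with x hx hxr
        rcases eq_or_ne (u (x - s • v)) 0 with h0 | hne
        · simp [h0]
        · gcongr
          exact hx (hxr hne)
    _ = K * (∫ x, ‖u x‖) * Real.exp (-(Real.pi * a) * s ^ 2) := by
        rw [integral_const_mul, integral_sub_right_eq_self (fun x => ‖u x‖)]
        ring

end GaussianBounds

section UncertaintyPrinciple

variable {d : ℕ} {A B C D M N : Matrix (Fin d) (Fin d) ℝ} {T : L2Space d ≃ₗᵢ[ℂ] L2Space d}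
  {L : Submodule ℝ (Euc d)} {g : L2Space d}

lemma integrable_exp_neg_mul_norm_sq {c : ℝ} (hc : 0 < c) :
    Integrable fun x : Euc d => Real.exp (-c * ‖x‖ ^ 2) := by
  refine (GaussianFourier.integrable_cexp_neg_mul_sq_norm_add (V := Euc d) (b := (c : ℂ))
    (by simpa using hc) 0 0).norm.congr (ae_of_all _ fun x => ?_)
  simp only [Complex.norm_exp]
  norm_cast
  simp

lemma integrable_exp_neg_mul_norm_sq_mul_norm {c : ℝ} (hc : 0 < c) (h : L2Space d) :
    Integrable fun x : Euc d => Real.exp (-c * ‖x‖ ^ 2) * ‖h x‖ := by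
  have hgauss : MemLp (fun x : Euc d => Real.exp (-c * ‖x‖ ^ 2)) 2 := by
    rw [memLp_two_iff_integrable_sq (by fun_prop)]
    refine (integrable_exp_neg_mul_norm_sq (c := 2 * c) (by positivity)).congr
      (ae_of_all _ fun x => ?_)
    simp only [← Real.exp_nat_mul]
    push_cast
    ring_nf
  exact hgauss.integrable_mul (Lp.memLp h).norm

theorem IsMetaplectic.inner_eq_zero_of_hasGaussianBound
    (hT : IsMetaplectic (Matrix.fromBlocks A B C D) T) (hM : M.PosSemidef)
    (hg : HasGaussianBound M (matKer M)ᗮ g) (hTg : HasGaussianBound N L (T g)) {y : Euc d}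
    (hlt : matQuad M y < matQuad N (Matrix.toEuclideanLin B (Matrix.toEuclideanLin M y)))
    {u : L2Space d} (hu : Integrable u) {r : ℝ} (hur : ∀ᵐ x, u x ≠ 0 → ‖x‖ ≤ r) :
    inner ℂ u (T g) = 0 := by
  obtain ⟨h, rfl⟩ := T.surjective u
  obtain ⟨b, hyb, hb⟩ := exists_between hlt
  obtain ⟨a, hba, ha⟩ := exists_between hb
  have hb0 : 0 ≤ b := (matQuad_nonneg hM y).trans hyb.le
  obtain ⟨K, c, hc, hgrowth⟩ := hg.exists_exp_mul_norm_le hM hyb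
  obtain ⟨K', hdecay⟩ := hTg.exists_norm_crossAmbiguity_le ha hu hur
  set w := Matrix.toEuclideanLin M y
  have hlaplace (R : ℝ) : ∀ᵐ x, Real.exp (R * (-(2 * Real.pi) * inner ℝ w x)) *
      ‖g x * starRingEnd ℂ (h x)‖ ≤
        Real.exp (Real.pi * b * R ^ 2) * (K * (Real.exp (-c * ‖x‖ ^ 2) * ‖h x‖)) := by
    filter_upwards [hgrowth (-R)] with x hx
    have hphase : R * (-(2 * Real.pi) * inner ℝ w x) = 2 * Real.pi * -R * inner ℝ w x := by ring
    rw [neg_sq] at hx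
    rw [norm_mul, RCLike.norm_conj, hphase, ← mul_assoc, ← mul_assoc K, ← mul_assoc]
    exact mul_le_mul_of_nonneg_right hx (norm_nonneg _)
  have hfourier (s : ℝ) : ‖∫ x, Complex.exp (s * Complex.I * ↑(-(2 * Real.pi) * inner ℝ w x)) •
      (g x * starRingEnd ℂ (h x))‖ ≤ K' * Real.exp (-(Real.pi * a) * s ^ 2) := by
    rw [← crossAmbiguity_zero_smul, ← hT.crossAmbiguity_fromBlocks, map_smul]
    exact hdecay s _
  rw [T.inner_map_map, ← integral_mul_conj_eq_inner]
  exact integral_eq_zero_of_gaussian_bounds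
    ((Lp.aestronglyMeasurable g).mul
      (RCLike.continuous_conj.comp_aestronglyMeasurable (Lp.aestronglyMeasurable h)))
    (by fun_prop) ((integrable_exp_neg_mul_norm_sq_mul_norm hc h).const_mul K)
    (by positivity) (by gcongr) hlaplace hfourier

theorem IsMetaplectic.eq_zero_of_hasGaussianBound
    (hT : IsMetaplectic (Matrix.fromBlocks A B C D) T) (hM : M.PosSemidef)
    (hg : HasGaussianBound M (matKer M)ᗮ g) (hTg : HasGaussianBound N L (T g)) {y : Euc d}
    (hlt : matQuad M y < matQuad N (Matrix.toEuclideanLin B (Matrix.toEuclideanLin M y))) :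
    g = 0 := by
  have hTg0 : T g =ᵐ[volume] 0 := by
    refine ae_eq_zero_of_forall_setIntegral_isCompact_eq_zero'
      ((Lp.memLp (T g)).locallyIntegrable one_le_two) fun k hk => ?_
    obtain ⟨r, hr⟩ := hk.isBounded.exists_norm_le
    rw [← L2.inner_indicatorConstLp_one (𝕜 := ℂ) hk.measurableSet hk.measure_ne_top]
    refine hT.inner_eq_zero_of_hasGaussianBound hM hg hTg hlt
      (integrable_indicatorConstLp hk.measurableSet hk.measure_ne_top _) (r := r) ?_
    filter_upwards [indicatorConstLp_coeFn (p := 2) (hs := hk.measurableSet)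
      (hμs := hk.measure_ne_top) (c := (1 : ℂ))] with x hx hne
    exact hr x (Set.mem_of_indicator_ne_zero (hx ▸ hne))
  exact (map_eq_zero_iff T T.injective).1 ((Lp.eq_zero_iff_ae_eq_zero).2 hTg0)

end UncertaintyPrinciple

section SublevelSets

variable {d : ℕ} {K : Submodule ℝ (Euc d)} {γ : K → ENNReal}

/-- The points of norm at most `n` at which `γ ≤ n`. These sets exhaust `{γ < ⊤}`. -/
def boundedSublevel (γ : K → ENNReal) (n : ℕ) : Set K :=
  {k | γ k ≤ n ∧ ‖k‖ ≤ n}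

lemma measurableSet_boundedSublevel (hγ : Measurable γ) (n : ℕ) :
    MeasurableSet (boundedSublevel γ n) :=
  (measurableSet_le hγ measurable_const).inter (measurableSet_le measurable_norm measurable_const)

lemma exists_mem_boundedSublevel {k : K} (hk : γ k < ⊤) : ∃ n, k ∈ boundedSublevel γ n := by
  obtain ⟨n₁, hn₁⟩ := ENNReal.exists_nat_gt hk.ne
  obtain ⟨n₂, hn₂⟩ := exists_nat_ge ‖k‖
  refine ⟨max n₁ n₂, hn₁.le.trans ?_, hn₂.trans ?_⟩
  · gcongr
    exact le_max_left _ _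
  · gcongr
    exact le_max_right _ _

end SublevelSets

theorem mainTheorem2_general {d : ℕ} (A B C D : Matrix (Fin d) (Fin d) ℝ)
    (T : L2Space d ≃ₗᵢ[ℂ] L2Space d)
    (hT : IsMetaplectic (Matrix.fromBlocks A B C D) T)
    (M N : Matrix (Fin d) (Fin d) ℝ) (hM : M.PosSemidef) (hMB : matKer M ≤ matKer B)
    (f : L2Space d)
    (α : matImage (D.transpose * A) (matKer B) → ENNReal)
    (β : matImage A (matKer B) → ENNReal)
    (hα : Measurable α) (hα_fin : ∀ᵐ x₂ ∂lebesgueOn (matImage (D.transpose * A) (matKer B)),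
      α x₂ < ⊤)
    (hβ : Measurable β) (hβ_fin : ∀ᵐ ξ₂ ∂lebesgueOn (matImage A (matKer B)), β ξ₂ < ⊤)
    (hf : ∀ᵐ x₂ : matImage (D.transpose * A) (matKer B)
        ∂lebesgueOn (matImage (D.transpose * A) (matKer B)),
      ∀ᵐ x₁ : (matKer B)ᗮ ∂lebesgueOn (matKer B)ᗮ,
        ‖f ((x₁ : Euc d) + (x₂ : Euc d))‖ₑ ≤
          α x₂ * ENNReal.ofReal (Real.exp (-Real.pi * matQuad M x₁)))
    (hTf : ∀ᵐ ξ₂ : matImage A (matKer B) ∂lebesgueOn (matImage A (matKer B)),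
      ∀ᵐ ξ₁ : matRange B ∂lebesgueOn (matRange B),
        ‖(T f) ((ξ₁ : Euc d) + (ξ₂ : Euc d))‖ₑ ≤
          β ξ₂ * ENNReal.ofReal (Real.exp (-Real.pi * matQuad N ξ₁)))
    (hlam : ∃ lam : ℝ, 1 < lam ∧
      Module.End.HasEigenvalue (Matrix.toLin' (M * B.transpose * N * B)) lam) :
    (f : Euc d → ℂ) =ᵐ[volume] 0 := by
  obtain ⟨lam, hlam, heig⟩ := hlam
  obtain ⟨y, hlt⟩ := exists_matQuad_lt_of_hasEigenvalue hM hlam heig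
  set ι := (Matrix.toEuclideanLin (D.transpose * A)).submoduleMap (matKer B)
  set ι' := (Matrix.toEuclideanLin A).submoduleMap (matKer B)
  set γ : matKer B → ENNReal := fun k => max (α (ι k)) (β (ι' k))
  have hγ : Measurable γ :=
    (hα.comp ι.continuous_of_finiteDimensional.measurable).max
      (hβ.comp ι'.continuous_of_finiteDimensional.measurable)
  have hs := measurableSet_boundedSublevel hγ
  refine ae_eq_zero_of_cutoff_eq_zero (fun n => (kerCoord B).measurable (hs n)) (fun n => ?_) ?_
  · have hsource := hasGaussianBound_cutoff ker_kerCoord (kerCoord_transpose_mul_apply hT.1) hα hf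
      (hs n) fun k hk => ⟨(le_max_left _ _).trans hk.1, hk.2⟩
    have htarget := hasGaussianBound_cutoff (ker_kerCoordTarget hT.1) (kerCoordTarget_apply hT.1)
      hβ hTf (hs n) fun k hk => ⟨(le_max_right _ _).trans hk.1, hk.2⟩
    rw [← hT.map_cutoff (hs n)] at htarget
    exact hT.eq_zero_of_hasGaussianBound hM (hsource.mono (Submodule.orthogonal_le hMB)) htarget hlt
  · filter_upwards [ae_lt_top_comp_of_surjective kerCoord_surjective hα hα_fin,
      ae_lt_top_comp_of_surjective kerCoord_surjective hβ hβ_fin] with x hx hx'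
    exact exists_mem_boundedSublevel (max_lt hx hx')

end

theorem mainTheorem2 {d : ℕ} (A B C D : Matrix (Fin d) (Fin d) ℝ)
    (T : L2Space d ≃ₗᵢ[ℂ] L2Space d)
    (hT : IsMetaplectic (Matrix.fromBlocks A B C D) T)
    (hB : 1 ≤ B.rank)
    (M N : Matrix (Fin d) (Fin d) ℝ) (hM : M.PosSemidef) (hN : N.PosSemidef)
    (hMB : matKer M = matKer B) (hNB : matRange N = matRange B)
    (f : L2Space d)
    (α : matImage (D.transpose * A) (matKer B) → ENNReal)
    (β : matImage A (matKer B) → ENNReal)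
    (hα : Measurable α) (hα_fin : ∀ᵐ x₂ ∂lebesgueOn (matImage (D.transpose * A) (matKer B)),
      α x₂ < ⊤)
    (hβ : Measurable β) (hβ_fin : ∀ᵐ ξ₂ ∂lebesgueOn (matImage A (matKer B)), β ξ₂ < ⊤)
    (hf : ∀ᵐ x₂ : matImage (D.transpose * A) (matKer B)
        ∂lebesgueOn (matImage (D.transpose * A) (matKer B)),
      ∀ᵐ x₁ : (matKer B)ᗮ ∂lebesgueOn (matKer B)ᗮ,
        ‖f ((x₁ : Euc d) + (x₂ : Euc d))‖ₑ ≤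
          α x₂ * ENNReal.ofReal (Real.exp (-Real.pi * matQuad M x₁)))
    (hTf : ∀ᵐ ξ₂ : matImage A (matKer B) ∂lebesgueOn (matImage A (matKer B)),
      ∀ᵐ ξ₁ : matRange B ∂lebesgueOn (matRange B),
        ‖(T f) ((ξ₁ : Euc d) + (ξ₂ : Euc d))‖ₑ ≤
          β ξ₂ * ENNReal.ofReal (Real.exp (-Real.pi * matQuad N ξ₁)))
    (hlam : ∃ lam : ℝ, 1 < lam ∧
      Module.End.HasEigenvalue (Matrix.toLin' (M * B.transpose * N * B)) lam) :
    (f : Euc d → ℂ) =ᵐ[volume] 0 :=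
  mainTheorem2_general A B C D T hT M N hM hMB.le f α β hα hα_fin hβ hβ_fin hf hTf hlam
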